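/- Let $p$ be an odd prime and $v$ a primitive root modulo $p$. For $n\in\mathbb Z$ let $[v^n]$ denote the integer in $\{1,\dots,p-1\}$ congruent to $v^n$ modulo $p$ (for $n<0$, $v^{n}$ is the inverse of $v^{-n}$ modulo $p$), and let $$\delta_i=\frac{[v^{-(i-1)}]-[v^{-i}]\,[v]}{p}\in\mathbb Z\qquad(1\le i\le p-2).$$ Consider the congruence $$\sum_{i=1}^{p-2}X^{i-1}\,\delta_i\equiv 0 \pmod p.\qquad(*)$$ The prime $p$ is called regular if $p$ does not divide the class number of $\mathbb Q(\zeta_p)$. (1) If $(*)$ has no solution $X\in\mathbb Z$, then $p$ is regular. (2) Suppose that $p$ does not divide the class number of the maximal real subfield $\mathbb Q(\zeta_p)^+$. If none of the integers $X=[v^{2m+1}]$ with $1\le m\le\frac{p-3}{2}$ is a solution of $(*)$, then $p$ is regular. -/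

import Mathlib

/-- `powRep v n` is the representative in `{1, …, p - 1}` of the residue class `v ^ n` modulo `p`,
for an invertible residue class `v` modulo `p` and an integer exponent `n` of any sign. -/
def powRep {p : ℕ} (v : (ZMod p)ˣ) (n : ℤ) : ℤ :=
  (((v ^ n : (ZMod p)ˣ) : ZMod p).val : ℤ)

/-- `δ_i = (v^{-(i-1)} - v^{-i} · v) / p`, where `v^n` stands for `powRep v n`
(so the factor `v` is the representative of `v` in `{1, …, p - 1}`).
The division is exact, see `dvd_delta_numerator`. -/
def delta {p : ℕ} (v : (ZMod p)ˣ) (i : ℕ) : ℤ :=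
  (powRep v (-((i : ℤ) - 1)) - powRep v (-(i : ℤ)) * powRep v 1) / (p : ℤ)

theorem dvd_delta_numerator {p : ℕ} [NeZero p] (v : (ZMod p)ˣ) (i : ℕ) :
    (p : ℤ) ∣ powRep v (-((i : ℤ) - 1)) - powRep v (-(i : ℤ)) * powRep v 1 := by
  rw [← ZMod.intCast_zmod_eq_zero_iff_dvd]
  have h : ∀ n : ℤ, ((powRep v n : ℤ) : ZMod p) = ((v ^ n : (ZMod p)ˣ) : ZMod p) := by
    intro n
    simp [powRep]
  push_cast
  rw [h, h, h, ← Units.val_mul, ← zpow_add,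
    show -((i : ℤ) - 1) = -(i : ℤ) + 1 by ring, sub_self]

theorem powRep_mem_Icc {p : ℕ} [Fact p.Prime] (v : (ZMod p)ˣ) (n : ℤ) :
    powRep v n ∈ Set.Icc (1 : ℤ) ((p : ℤ) - 1) := by
  have h0 : ((v ^ n : (ZMod p)ˣ) : ZMod p).val ≠ 0 := by
    rw [Ne, ZMod.val_eq_zero]
    exact Units.ne_zero _
  have h1 := ZMod.val_lt ((v ^ n : (ZMod p)ˣ) : ZMod p)
  simp only [powRep, Set.mem_Icc]
  omega

/-- `X` solves the congruence `∑_{i=1}^{p-2} X^{i-1} · δ_i ≡ 0 mod p`. -/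
def SolvesCongruence {p : ℕ} (v : (ZMod p)ˣ) (X : ℤ) : Prop :=
  ∑ i ∈ Finset.Icc 1 (p - 2), X ^ (i - 1) * delta v i ≡ 0 [ZMOD (p : ℤ)]

/-- A prime `p` is regular if it does not divide the class number of `ℚ(ζ_p)`. -/
def IsRegularPrime (p : ℕ) [Fact p.Prime] : Prop :=
  ¬ p ∣ NumberField.classNumber (CyclotomicField p ℚ)

/-! Suppose p divides the class number of K = ℚ(ζ_p). The cyclic Galois group has order p - 1, so on
the p-torsion of the class group it has an eigenvector over 𝔽_p: a class c of order p with σ_a c =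
c^(a^k) for all a (`exists_eigenclass`). Write ⟨a⟩ for the least nonnegative residue and S_j for the
set of a with ⟨a⟩ + ⟨ja⟩ < p. Stickelberger's relation ∏_{a ∈ S_j} σ_a⁻¹ c = 1 becomes ∑_{a ∈ S_j}
a^(-k) ≡ 0, and the sum over the complement -S_j vanishes too. Adding the complementary sums for j <
m gives ∑ ⌊m⟨a⟩/p⌋ a^(-k) ≡ 0. With m = [v] and a = v^(-i) the floor is -δ_i, so X = v^k solves the
congruence. For (2), an even k would make c² come from the real subfield, and k = 1 is refuted by m
= p - 1. The relations are proved for primes of prime norm l ≠ p, where a Jacobi sum generates the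
required product of conjugates. These primes suffice: classes of primes of prime norm generate the
class group (`eq_top_of_forall_mk0_mem`, a sieve resting on the equidistribution of ideals among
classes), and a prime of norm p is principal. -/

/-! ### Generation of the class group by primes of prime norm -/

section DegreeOnePrimes

open Filter Topology NumberField Ideal IsDedekindDomain
open scoped nonZeroDivisors

variable (K : Type*) [Field K] [NumberField K]

/-- The nonzero integral ideals of norm at most `x`, in the ideal class `c`, and divisible by no
prime ideal of the finite set `T`. -/
def siftedIdeals (T : Finset (HeightOneSpectrum (𝓞 K))) (c : ClassGroup (𝓞 K)) (x : ℝ) :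
    Set (Ideal (𝓞 K))⁰ :=
  {I | (absNorm (I : Ideal (𝓞 K)) : ℝ) ≤ x ∧ ClassGroup.mk0 I = c ∧ ∀ P ∈ T, ¬ P.asIdeal ∣ I.1}

theorem finite_setOf_absNorm_le_real (x : ℝ) :
    {I : (Ideal (𝓞 K))⁰ | (absNorm (I : Ideal (𝓞 K)) : ℝ) ≤ x}.Finite := by
  refine (finite_setOfPred_absNorm_le₀ (S := 𝓞 K) ⌊x⌋₊).subset ?_
  intro I hI
  exact Nat.le_floor hI

theorem finite_siftedIdeals (T : Finset (HeightOneSpectrum (𝓞 K))) (c : ClassGroup (𝓞 K))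
    (x : ℝ) : (siftedIdeals K T c x).Finite :=
  (finite_setOf_absNorm_le_real K x).subset fun _ hI ↦ hI.1

variable {K} in
/-- A maximal ideal, as a nonzero divisor in the monoid of ideals. -/
def HeightOneSpectrum.toNonZeroDivisors (P : HeightOneSpectrum (𝓞 K)) : (Ideal (𝓞 K))⁰ :=
  ⟨P.asIdeal, mem_nonZeroDivisors_of_ne_zero P.ne_bot⟩

variable {K} in
theorem HeightOneSpectrum.absNorm_pos (P : HeightOneSpectrum (𝓞 K)) :
    (0 : ℝ) < absNorm P.asIdeal :=
  Nat.cast_pos.mpr (absNorm_pos_of_nonZeroDivisors (HeightOneSpectrum.toNonZeroDivisors P))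

variable {K} in
theorem HeightOneSpectrum.two_le_absNorm (P : HeightOneSpectrum (𝓞 K)) :
    2 ≤ absNorm P.asIdeal := by
  have h0 : 0 < absNorm P.asIdeal := by exact_mod_cast HeightOneSpectrum.absNorm_pos P
  have h1 : absNorm P.asIdeal ≠ 1 := by
    rw [Ne, absNorm_eq_one_iff]
    exact P.isPrime.ne_top
  omega

/-- One sieve step: the ideals lost on adding P to T are the multiples of P, and dividing by P is a
bijection onto sifted ideals of smaller norm in a shifted class. -/
theorem ncard_siftedIdeals_insert [DecidableEq (HeightOneSpectrum (𝓞 K))]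
    {T : Finset (HeightOneSpectrum (𝓞 K))} {P : HeightOneSpectrum (𝓞 K)} (hP : P ∉ T)
    (c : ClassGroup (𝓞 K)) (x : ℝ) :
    (siftedIdeals K T c x).ncard = (siftedIdeals K (insert P T) c x).ncard +
      (siftedIdeals K T (c * (ClassGroup.mk0 (HeightOneSpectrum.toNonZeroDivisors P))⁻¹)
        (x / absNorm P.asIdeal)).ncard := by
  have hP0 := HeightOneSpectrum.absNorm_pos P
  set π := HeightOneSpectrum.toNonZeroDivisors P with hπ
  have himg : siftedIdeals K T c x = siftedIdeals K (insert P T) c x ∪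
      (fun I ↦ π * I) '' siftedIdeals K T (c * (ClassGroup.mk0 π)⁻¹) (x / absNorm P.asIdeal) := by
    ext I
    simp only [siftedIdeals, Set.mem_ofPred_eq, Set.mem_union, Set.mem_image,
      Finset.forall_mem_insert]
    constructor
    · rintro ⟨h1, h2, h3⟩
      by_cases hd : P.asIdeal ∣ I.1
      · right
        obtain ⟨J, hJ⟩ := hd
        have hJ0 : J ≠ 0 := by
          rintro rfl
          exact nonZeroDivisors.coe_ne_zero I (by simp [hJ])
        refine ⟨⟨J, mem_nonZeroDivisors_of_ne_zero hJ0⟩, ⟨?_, ?_, ?_⟩, ?_⟩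
        · rw [le_div_iff₀ hP0, mul_comm]
          rw [hJ, map_mul] at h1
          exact_mod_cast h1
        · rw [eq_mul_inv_iff_mul_eq, ← h2, mul_comm, ← map_mul]
          congr 1
          exact Subtype.ext hJ.symm
        · intro Q hQ hQJ
          exact h3 Q hQ (hJ ▸ hQJ.mul_left _)
        · exact Subtype.ext hJ.symm
      · exact Or.inl ⟨h1, h2, hd, h3⟩
    · rintro (⟨h1, h2, h3, h4⟩ | ⟨J, ⟨h1, h2, h3⟩, rfl⟩)
      · exact ⟨h1, h2, h4⟩
      · refine ⟨?_, ?_, ?_⟩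
        · rw [le_div_iff₀ hP0, mul_comm] at h1
          have : absNorm ((π * J : (Ideal (𝓞 K))⁰) : Ideal (𝓞 K)) =
              absNorm P.asIdeal * absNorm J.1 := map_mul absNorm P.asIdeal J.1
          rw [this]
          exact_mod_cast h1
        · rw [map_mul, h2]
          simp
        · intro Q hQ hQJ
          rcases Q.prime.dvd_or_dvd (show Q.asIdeal ∣ P.asIdeal * J.1 from hQJ) with h | h
          · refine hP ?_
            have := (Prime.dvd_prime_iff_associated Q.prime P.prime).mp h
            rw [associated_iff_eq] at this
            rwa [← HeightOneSpectrum.ext this]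
          · exact h3 Q hQ h
  have hinj : Function.Injective (fun I : (Ideal (𝓞 K))⁰ ↦ π * I) := fun I J h ↦
    Subtype.ext (mul_left_cancel₀ P.ne_bot (congrArg Subtype.val h))
  rw [← Set.ncard_image_of_injective (siftedIdeals K T (c * _) _) hinj, ← Set.ncard_union_eq _
    (finite_siftedIdeals K _ _ _) ((finite_siftedIdeals K _ _ _).image _), ← himg]
  rw [Set.disjoint_left]
  rintro _ ⟨-, -, h⟩ ⟨J, -, rfl⟩
  exact h P (Finset.mem_insert_self _ _) (Dvd.intro J.1 rfl)

/-- The same κ serves every class, so the shift of class in a sieve step is harmless and each prime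
contributes a factor 1 - 1/N(P). -/
theorem exists_tendsto_ncard_siftedIdeals_div :
    ∃ κ : ℝ, 0 < κ ∧ ∀ (T : Finset (HeightOneSpectrum (𝓞 K))) (c : ClassGroup (𝓞 K)),
      Tendsto (fun x : ℝ ↦ ((siftedIdeals K T c x).ncard : ℝ) / x) atTop
        (𝓝 (κ * ∏ P ∈ T, (1 - (absNorm P.asIdeal : ℝ)⁻¹))) := by
  classical
  refine ⟨(2 ^ InfinitePlace.nrRealPlaces K * (2 * Real.pi) ^ InfinitePlace.nrComplexPlaces K *
    Units.regulator K) / (Units.torsionOrder K * Real.sqrt |(discr K : ℝ)|), ?_, fun T ↦ ?_⟩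
  rotate_left
  · induction T using Finset.induction_on with
    | empty =>
      intro c
      rw [Finset.prod_empty, mul_one]
      refine (NumberField.Ideal.tendsto_norm_le_and_mk_eq_div_atTop K c).congr fun x ↦ ?_
      simp only [siftedIdeals, Finset.notMem_empty, false_imp_iff, implies_true, and_true]
      rfl
    | insert P T hP ih =>
      intro c
      have hP0 := HeightOneSpectrum.absNorm_pos P
      have h1 := ih c
      have h2 := ((ih (c * (ClassGroup.mk0 (HeightOneSpectrum.toNonZeroDivisors P))⁻¹)).comp
        (tendsto_id.atTop_div_const hP0)).mul_const (absNorm P.asIdeal : ℝ)⁻¹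
      rw [Finset.prod_insert hP]
      convert h1.sub h2 using 1
      · ext x
        rw [ncard_siftedIdeals_insert K hP]
        simp only [Function.comp, id]
        push_cast
        field_simp
        ring
      · congr 1
        ring
  · have := NumberField.Units.regulator_pos K
    have h2 := NumberField.discr_ne_zero K
    have h3 : 0 < NumberField.Units.torsionOrder K :=
      Nat.pos_of_ne_zero (NumberField.Units.torsionOrder_ne_zero K)
    positivity

/-- Uniformity in all x > 0 is the point: the bound is used at x / N(P) for many P at once. Below 1
there are no ideals. -/
theorem exists_ncard_absNorm_le_le_mul :
    ∃ M : ℝ, 0 ≤ M ∧ ∀ x : ℝ, 0 < x →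
      ({I : (Ideal (𝓞 K))⁰ | (absNorm (I : Ideal (𝓞 K)) : ℝ) ≤ x}.ncard : ℝ) ≤ M * x := by
  have h := NumberField.Ideal.tendsto_norm_le_div_atTop₀ K
  set L := ((2 ^ InfinitePlace.nrRealPlaces K * (2 * Real.pi) ^ InfinitePlace.nrComplexPlaces K *
    Units.regulator K * classNumber K) / (Units.torsionOrder K * Real.sqrt |(discr K : ℝ)|))
  obtain ⟨x₀, hx₀⟩ := (h.eventually_le_const (lt_add_one L)).exists_forall_of_atTop
  set N := fun x : ℝ ↦ ({I : (Ideal (𝓞 K))⁰ | (absNorm (I : Ideal (𝓞 K)) : ℝ) ≤ x}.ncard : ℝ)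
  refine ⟨max (L + 1) (N x₀), (Nat.cast_nonneg _).trans (le_max_right _ _), fun x hx ↦ ?_⟩
  rcases lt_or_ge x 1 with hx1 | hx1
  · have : {I : (Ideal (𝓞 K))⁰ | (absNorm (I : Ideal (𝓞 K)) : ℝ) ≤ x} = ∅ := by
      rw [Set.eq_empty_iff_forall_notMem]
      intro I hI
      have h1 : (1 : ℝ) ≤ absNorm (I : Ideal (𝓞 K)) := by
        exact_mod_cast absNorm_pos_of_nonZeroDivisors I
      exact absurd (h1.trans hI) (not_le.mpr hx1)
    rw [this, Set.ncard_empty, Nat.cast_zero]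
    have : (0 : ℝ) ≤ N x₀ := Nat.cast_nonneg _
    have := this.trans (le_max_right (L + 1) (N x₀))
    positivity
  · rcases le_total x₀ x with h' | h'
    · have := hx₀ x h'
      rw [div_le_iff₀ hx] at this
      exact this.trans (mul_le_mul_of_nonneg_right (le_max_left _ _) hx.le)
    · have h1 : N x ≤ N x₀ := by
        refine Nat.cast_le.mpr (Set.ncard_le_ncard ?_ (finite_setOf_absNorm_le_real K x₀))
        exact fun I hI ↦ le_trans hI h'
      have h0 : (0 : ℝ) ≤ N x₀ := Nat.cast_nonneg _
      calc N x ≤ N x₀ := h1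
        _ ≤ max (L + 1) (N x₀) := le_max_right _ _
        _ ≤ max (L + 1) (N x₀) * x := le_mul_of_one_le_right (h0.trans (le_max_right _ _)) hx1

theorem ncard_absNorm_le_dvd_le (P : HeightOneSpectrum (𝓞 K)) (x : ℝ) :
    {I : (Ideal (𝓞 K))⁰ | (absNorm (I : Ideal (𝓞 K)) : ℝ) ≤ x ∧ P.asIdeal ∣ I.1}.ncard ≤
      {I : (Ideal (𝓞 K))⁰ | (absNorm (I : Ideal (𝓞 K)) : ℝ) ≤ x / absNorm P.asIdeal}.ncard := by
  have hP0 := HeightOneSpectrum.absNorm_pos P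
  refine (Set.ncard_le_ncard ?_ ((finite_setOf_absNorm_le_real K _).image
    (fun I ↦ HeightOneSpectrum.toNonZeroDivisors P * I))).trans
    (Set.ncard_image_le (finite_setOf_absNorm_le_real K _))
  rintro I ⟨h1, J, hJ⟩
  have hJ0 : J ≠ 0 := by
    rintro rfl
    exact nonZeroDivisors.coe_ne_zero I (by simp [hJ])
  refine ⟨⟨J, mem_nonZeroDivisors_of_ne_zero hJ0⟩, ?_, Subtype.ext hJ.symm⟩
  rw [Set.mem_ofPred_eq, le_div_iff₀ hP0, mul_comm]
  rw [hJ, map_mul] at h1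
  exact_mod_cast h1

variable {K} in
theorem HeightOneSpectrum.card_le_finrank_of_natCast_mem {l : ℕ} (hl : l.Prime)
    (T : Finset (HeightOneSpectrum (𝓞 K))) (hT : ∀ P ∈ T, (l : 𝓞 K) ∈ P.asIdeal) :
    T.card ≤ Module.finrank ℤ (𝓞 K) := by
  classical
  have hdvd : ∏ P ∈ T, P.asIdeal ∣ span {(l : 𝓞 K)} := by
    refine Finset.prod_dvd_of_isRelPrime ?_ ?_
    · intro P _ Q _ hPQ
      refine (Irreducible.isRelPrime_iff_not_dvd P.irreducible).mpr fun h ↦ hPQ ?_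
      have := (Prime.dvd_prime_iff_associated P.prime Q.prime).mp h
      rw [associated_iff_eq] at this
      exact HeightOneSpectrum.ext this
    · intro P hP
      rw [dvd_span_singleton]
      exact hT P hP
  have h1 := map_dvd absNorm hdvd
  rw [map_prod, absNorm_span_natCast] at h1
  have h2 : l ^ T.card ∣ ∏ P ∈ T, absNorm P.asIdeal := by
    rw [← Finset.prod_const]
    refine Finset.prod_dvd_prod_of_dvd _ _ fun P hP ↦ ?_
    have h3 : absNorm P.asIdeal ∣ l ^ Module.finrank ℤ (𝓞 K) := by
      rw [← absNorm_span_natCast]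
      exact map_dvd absNorm (dvd_span_singleton.mpr (hT P hP))
    obtain ⟨k, -, hk⟩ := (Nat.dvd_prime_pow hl).mp h3
    have h4 := HeightOneSpectrum.two_le_absNorm P
    rw [hk] at h4 ⊢
    refine dvd_pow_self l ?_
    rintro rfl
    simp at h4
  exact (Nat.pow_dvd_pow_iff_le_right hl.one_lt).mp (h2.trans h1)

/-- The reciprocals of the norms of the prime ideals of residue degree at least two are
summable. -/
theorem summable_inv_absNorm_of_not_prime :
    Summable ({P : HeightOneSpectrum (𝓞 K) | ¬ (absNorm P.asIdeal).Prime}.indicator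
      fun P ↦ (absNorm P.asIdeal : ℝ)⁻¹) := by
  classical
  have hex : ∀ P : HeightOneSpectrum (𝓞 K), ∃ l : ℕ, l.Prime ∧ (l : 𝓞 K) ∈ P.asIdeal ∧
      (¬ (absNorm P.asIdeal).Prime → l ^ 2 ≤ absNorm P.asIdeal) := by
    intro P
    have := P.isMaximal
    obtain ⟨l, n, hn, hmem, hl, hN⟩ := exists_prime_and_absNorm_eq_pow P.asIdeal
    refine ⟨l, hl, hmem, fun hP ↦ ?_⟩
    rw [hN] at hP ⊢
    refine Nat.pow_le_pow_right hl.pos ?_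
    by_contra hn'
    obtain rfl : n = 1 := by omega
    exact hP (by simpa using hl)
  choose l hl hmem hle using hex
  have hsum : Summable fun m : ℕ ↦ ((m : ℝ) ^ 2)⁻¹ := Real.summable_nat_pow_inv.mpr one_lt_two
  refine summable_of_sum_le (c := Module.finrank ℤ (𝓞 K) * ∑' m : ℕ, ((m : ℝ) ^ 2)⁻¹)
    (fun P ↦ Set.indicator_nonneg (fun _ _ ↦ by positivity) P) fun u ↦ ?_
  -- Group the primes by residue characteristic l: at most [K : ℚ] lie over each l, and each
  -- contributes at most 1/l².
  calc ∑ P ∈ u, _ ≤ ∑ P ∈ u, ((l P : ℝ) ^ 2)⁻¹ := by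
        refine Finset.sum_le_sum fun P _ ↦ Set.indicator_le' (g := fun P ↦ ((l P : ℝ) ^ 2)⁻¹)
          (fun Q hQ ↦ ?_) (fun Q _ ↦ ?_) P
        · have h0 : (0 : ℝ) < (l Q : ℝ) ^ 2 := pow_pos (Nat.cast_pos.mpr (hl Q).pos) 2
          exact inv_anti₀ h0 (by exact_mod_cast hle Q hQ)
        · positivity
    _ = ∑ m ∈ u.image l, (u.filter (l · = m)).card • ((m : ℝ) ^ 2)⁻¹ :=
        Finset.sum_comp (fun m : ℕ ↦ ((m : ℝ) ^ 2)⁻¹) l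
    _ ≤ ∑ m ∈ u.image l, Module.finrank ℤ (𝓞 K) * ((m : ℝ) ^ 2)⁻¹ := by
        refine Finset.sum_le_sum fun m hm ↦ ?_
        obtain ⟨Q, -, rfl⟩ := Finset.mem_image.mp hm
        rw [nsmul_eq_mul]
        refine mul_le_mul_of_nonneg_right (Nat.cast_le.mpr ?_) (by positivity)
        refine HeightOneSpectrum.card_le_finrank_of_natCast_mem (hl Q) _ fun P hP ↦ ?_
        rw [← (Finset.mem_filter.mp hP).2]
        exact hmem P
    _ ≤ _ := by
        rw [← Finset.mul_sum]
        exact mul_le_mul_of_nonneg_left (hsum.sum_le_tsum _ fun _ _ ↦ by positivity)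
          (Nat.cast_nonneg _)

variable {K} in
theorem exists_dvd_mk0_notMem {H : Subgroup (ClassGroup (𝓞 K))} (I : (Ideal (𝓞 K))⁰)
    (hI : ClassGroup.mk0 I ∉ H) : ∃ P : HeightOneSpectrum (𝓞 K), P.asIdeal ∣ I.1 ∧
      ClassGroup.mk0 (HeightOneSpectrum.toNonZeroDivisors P) ∉ H := by
  by_contra! hcon
  suffices ∀ J : Ideal (𝓞 K), ∀ hJ : J ∈ (Ideal (𝓞 K))⁰, J ∣ I.1 → ClassGroup.mk0 ⟨J, hJ⟩ ∈ H from
    hI (this I.1 I.2 dvd_rfl)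
  intro J
  induction J using UniqueFactorizationMonoid.induction_on_prime with
  | h₁ => exact fun hJ ↦ absurd rfl (nonZeroDivisors.ne_zero hJ)
  | h₂ J hJu =>
    intro hJ _
    rw [Ideal.isUnit_iff] at hJu
    have : (⟨J, hJ⟩ : (Ideal (𝓞 K))⁰) = 1 := Subtype.ext (hJu.trans Ideal.one_eq_top.symm)
    rw [this, map_one]
    exact H.one_mem
  | h₃ J P hJ0 hP ih =>
    intro hPJ hdvd
    have h1 := ih (mem_nonZeroDivisors_of_ne_zero hJ0) ((dvd_mul_left _ _).trans hdvd)
    have h2 := hcon ⟨P, Ideal.isPrime_of_prime hP, hP.ne_zero⟩ ((dvd_mul_right _ _).trans hdvd)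
    have := H.mul_mem h2 h1
    rwa [← map_mul] at this

theorem one_sub_sum_le_prod_one_sub {ι : Type*} (s : Finset ι) (f : ι → ℝ)
    (h0 : ∀ i ∈ s, 0 ≤ f i) (h1 : ∀ i ∈ s, f i ≤ 1) :
    1 - ∑ i ∈ s, f i ≤ ∏ i ∈ s, (1 - f i) := by
  classical
  induction s using Finset.induction_on with
  | empty => simp
  | insert a s ha ih =>
    rw [Finset.sum_insert ha, Finset.prod_insert ha]
    have h2 := ih (fun i hi ↦ h0 i (Finset.mem_insert_of_mem hi))
      (fun i hi ↦ h1 i (Finset.mem_insert_of_mem hi))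
    have h3 := h0 a (Finset.mem_insert_self _ _)
    have h4 := h1 a (Finset.mem_insert_self _ _)
    have h5 : 0 ≤ ∑ i ∈ s, f i := Finset.sum_nonneg fun i hi ↦ h0 i (Finset.mem_insert_of_mem hi)
    nlinarith [mul_le_mul_of_nonneg_left h2 (sub_nonneg.mpr h4), mul_nonneg h3 h5]

/-- The class group of a number field is generated by the classes of the prime ideals of prime
norm. -/
theorem eq_top_of_forall_mk0_mem (H : Subgroup (ClassGroup (𝓞 K)))
    (hH : ∀ P : HeightOneSpectrum (𝓞 K), (absNorm P.asIdeal).Prime →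
      ClassGroup.mk0 (HeightOneSpectrum.toNonZeroDivisors P) ∈ H) : H = ⊤ := by
  classical
  by_contra hne
  -- Every ideal in c has a prime factor with class outside H, hence in B. Sieving by enough of B
  -- should leave density at least κδ/2 in c, yet the survivors are multiples of the remaining
  -- primes of B, of density at most κδ/4.
  obtain ⟨c, -, hc⟩ := SetLike.exists_of_lt (lt_top_iff_ne_top.mpr hne)
  set B := {P : HeightOneSpectrum (𝓞 K) | ¬ (absNorm P.asIdeal).Prime} with hB
  set f : HeightOneSpectrum (𝓞 K) → ℝ := fun P ↦ (absNorm P.asIdeal : ℝ)⁻¹ with hf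
  have hf0 : ∀ P, 0 < f P := fun P ↦ inv_pos.mpr (HeightOneSpectrum.absNorm_pos P)
  have hf1 : ∀ P, f P < 1 := fun P ↦ inv_lt_one_of_one_lt₀
    (by exact_mod_cast HeightOneSpectrum.two_le_absNorm P)
  have hsum : ∀ ε : ℝ, 0 < ε → ∃ s : Finset (HeightOneSpectrum (𝓞 K)), ∀ t,
      (∀ P ∈ t, P ∈ B) → Disjoint t s → ∑ P ∈ t, f P < ε := by
    intro ε hε
    obtain ⟨s, hs⟩ := summable_iff_vanishing_norm.mp (summable_inv_absNorm_of_not_prime K) ε hε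
    refine ⟨s, fun t ht hts ↦ ?_⟩
    have := (le_abs_self _).trans_lt (hs t hts)
    rwa [Finset.sum_congr rfl fun P hP ↦ Set.indicator_of_mem (ht P hP) _] at this
  obtain ⟨κ, hκ, hlim⟩ := exists_tendsto_ncard_siftedIdeals_div K
  obtain ⟨M, hM0, hM⟩ := exists_ncard_absNorm_le_le_mul K
  obtain ⟨S₀, hS₀⟩ := hsum (1 / 2) one_half_pos
  set δ := ∏ P ∈ S₀.filter (· ∈ B), (1 - f P) with hδ
  have hδ0 : 0 < δ := Finset.prod_pos fun P _ ↦ sub_pos.mpr (hf1 P)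
  -- S₀ keeps the sieve product above δ/2; S₁ makes M times the remaining tail at most κδ/4. M + 1
  -- avoids division by zero.
  obtain ⟨S₁, hS₁⟩ := hsum (κ * δ / (4 * (M + 1))) (by positivity)
  set T := (S₀ ∪ S₁).filter (· ∈ B) with hT
  have hprod : δ / 2 ≤ ∏ P ∈ T, (1 - f P) := by
    have hsub : S₀.filter (· ∈ B) ⊆ T := Finset.filter_subset_filter _ Finset.subset_union_left
    rw [← Finset.prod_sdiff hsub, ← hδ, div_eq_inv_mul]
    refine mul_le_mul_of_nonneg_right ?_ hδ0.le
    refine le_trans ?_ (one_sub_sum_le_prod_one_sub _ f (fun P _ ↦ (hf0 P).le)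
      (fun P _ ↦ (hf1 P).le))
    have := hS₀ (T \ S₀.filter (· ∈ B)) (fun P hP ↦ by
      exact (Finset.mem_filter.mp (Finset.mem_sdiff.mp hP).1).2) (by
        rw [Finset.disjoint_left]
        intro P hP hP'
        rw [Finset.mem_sdiff] at hP
        exact hP.2 (Finset.mem_filter.mpr ⟨hP', (Finset.mem_filter.mp hP.1).2⟩))
    linarith
  have hupper : ∀ x : ℝ, 0 < x → ((siftedIdeals K T c x).ncard : ℝ) / x ≤ κ * δ / 4 := by
    intro x hx
    set U := ((Ring.HasFiniteQuotients.finite_absNorm_heightOneSpectrum_le (R := 𝓞 K)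
      ⌊x⌋₊).toFinset).filter (fun P ↦ P ∈ B ∧ P ∉ T) with hU
    have hcov : siftedIdeals K T c x ⊆ ⋃ P ∈ U,
        {I : (Ideal (𝓞 K))⁰ | (absNorm (I : Ideal (𝓞 K)) : ℝ) ≤ x ∧ P.asIdeal ∣ I.1} := by
      rintro I ⟨h1, h2, h3⟩
      obtain ⟨P, hPI, hPH⟩ := exists_dvd_mk0_notMem (H := H) I (h2 ▸ hc)
      refine Set.mem_biUnion (x := P) ?_ ⟨h1, hPI⟩
      rw [hU, Finset.mem_coe, Finset.mem_filter]
      refine ⟨?_, fun h ↦ hPH (hH P h), fun h ↦ h3 P h hPI⟩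
      rw [Set.Finite.mem_toFinset]
      exact (Nat.le_of_dvd (absNorm_pos_of_nonZeroDivisors I) (map_dvd absNorm hPI)).trans
        (Nat.le_floor h1)
    have hUsum : ∑ P ∈ U, f P < κ * δ / (4 * (M + 1)) := by
      refine hS₁ U (fun P hP ↦ (Finset.mem_filter.mp hP).2.1) ?_
      rw [Finset.disjoint_left]
      intro P hP hP'
      have := (Finset.mem_filter.mp hP).2
      exact this.2 (Finset.mem_filter.mpr ⟨Finset.mem_union_right _ hP', this.1⟩)
    have hcard : ((siftedIdeals K T c x).ncard : ℝ) ≤ ∑ P ∈ U, M * x * f P := by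
      have hfin : (⋃ P ∈ U, {I : (Ideal (𝓞 K))⁰ |
          (absNorm (I : Ideal (𝓞 K)) : ℝ) ≤ x ∧ P.asIdeal ∣ I.1}).Finite :=
        U.finite_toSet.biUnion fun P _ ↦ (finite_setOf_absNorm_le_real K x).subset fun I h ↦ h.1
      refine (Nat.cast_le.mpr ((Set.ncard_le_ncard hcov hfin).trans
        (Finset.set_ncard_biUnion_le U _))).trans ?_
      rw [Nat.cast_sum]
      refine Finset.sum_le_sum fun P _ ↦ ?_
      refine (Nat.cast_le.mpr (ncard_absNorm_le_dvd_le K P x)).trans ?_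
      refine (hM _ (div_pos hx (HeightOneSpectrum.absNorm_pos P))).trans (le_of_eq ?_)
      simp only [hf]
      ring
    rw [div_le_iff₀ hx]
    rw [← Finset.mul_sum] at hcard
    have h2 : M * (∑ P ∈ U, f P) ≤ κ * δ / 4 := by
      have h3 : (M + 1) * (∑ P ∈ U, f P) ≤ (M + 1) * (κ * δ / (4 * (M + 1))) :=
        mul_le_mul_of_nonneg_left hUsum.le (by positivity)
      have h4 : (M + 1) * (κ * δ / (4 * (M + 1))) = κ * δ / 4 := by field_simp
      have h5 : 0 ≤ ∑ P ∈ U, f P := Finset.sum_nonneg fun P _ ↦ (hf0 P).le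
      linarith
    nlinarith
  have hle := le_of_tendsto (hlim T c) ((eventually_gt_atTop 0).mono hupper)
  have := mul_le_mul_of_nonneg_left hprod hκ.le
  have h6 : 0 < κ * δ := by positivity
  linarith

end DegreeOnePrimes

/-! ### Galois action on ideal classes -/

section ClassGroupMap

open scoped nonZeroDivisors

variable {R S : Type*} [CommRing R] [IsDedekindDomain R] [CommRing S] [IsDedekindDomain S]

/-- The homomorphism between class groups induced by a ring isomorphism. -/
noncomputable def ClassGroup.mapRingEquiv (f : R ≃+* S) : ClassGroup R →* ClassGroup S :=
  letI : Algebra R S := (f : R →+* S).toAlgebra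
  haveI : Module.IsTorsionFree R S :=
    Module.isTorsionFree_iff_algebraMap_injective.mpr f.injective
  ClassGroup.extendedHom R S

theorem ClassGroup.mapRingEquiv_mk0 (f : R ≃+* S) (I : (Ideal R)⁰) (J : (Ideal S)⁰)
    (h : I.1.map (f : R →+* S) = J.1) :
    ClassGroup.mapRingEquiv f (ClassGroup.mk0 I) = ClassGroup.mk0 J := by
  let : Algebra R S := (f : R →+* S).toAlgebra
  have : Module.IsTorsionFree R S :=
    Module.isTorsionFree_iff_algebraMap_injective.mpr f.injective
  rw [ClassGroup.mapRingEquiv, ClassGroup.extendedHom_mk0]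
  congr 1
  exact Subtype.ext h

open NumberField
open scoped Pointwise

variable (K : Type*) [Field K] [NumberField K]

theorem galois_smul_mem_nonZeroDivisors (σ : Gal(K/ℚ)) (I : (Ideal (𝓞 K))⁰) :
    σ • I.1 ∈ (Ideal (𝓞 K))⁰ := by
  refine mem_nonZeroDivisors_of_ne_zero fun h ↦ nonZeroDivisors.coe_ne_zero I ?_
  rwa [smul_eq_iff_eq_inv_smul, smul_zero] at h

/-- The endomorphism of the class group induced by a Galois automorphism. -/
noncomputable def galClassMap (σ : Gal(K/ℚ)) : ClassGroup (𝓞 K) →* ClassGroup (𝓞 K) :=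
  ClassGroup.mapRingEquiv (MulSemiringAction.toRingEquiv Gal(K/ℚ) (𝓞 K) σ)

theorem galClassMap_mk0 (σ : Gal(K/ℚ)) (I J : (Ideal (𝓞 K))⁰) (h : σ • I.1 = J.1) :
    galClassMap K σ (ClassGroup.mk0 I) = ClassGroup.mk0 J :=
  ClassGroup.mapRingEquiv_mk0 _ I J h

theorem galClassMap_one (c : ClassGroup (𝓞 K)) : galClassMap K 1 c = c := by
  obtain ⟨I, rfl⟩ := ClassGroup.mk0_surjective c
  exact galClassMap_mk0 K 1 I I (one_smul _ _)

theorem galClassMap_mul (σ τ : Gal(K/ℚ)) (c : ClassGroup (𝓞 K)) :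
    galClassMap K (σ * τ) c = galClassMap K σ (galClassMap K τ c) := by
  obtain ⟨I, rfl⟩ := ClassGroup.mk0_surjective c
  rw [galClassMap_mk0 K τ I ⟨τ • I.1, galois_smul_mem_nonZeroDivisors K τ I⟩ rfl]
  exact (galClassMap_mk0 K (σ * τ) I ⟨_, galois_smul_mem_nonZeroDivisors K (σ * τ) I⟩ rfl).trans
    (galClassMap_mk0 K σ ⟨τ • I.1, galois_smul_mem_nonZeroDivisors K τ I⟩ _
      (mul_smul σ τ I.1).symm).symm

theorem absNorm_galois_smul (σ : Gal(K/ℚ)) (I : Ideal (𝓞 K)) :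
    Ideal.absNorm (σ • I) = Ideal.absNorm I := by
  rw [Ideal.absNorm_apply, Ideal.absNorm_apply, Submodule.cardQuot_apply, Submodule.cardQuot_apply]
  exact (Nat.card_congr (Ideal.quotientEquiv I (σ • I)
    (MulSemiringAction.toRingEquiv Gal(K/ℚ) (𝓞 K) σ) rfl).toEquiv).symm

end ClassGroupMap

/-! ### Power residue characters and Jacobi sums -/

section JacobiSums

open Polynomial

theorem FiniteField.sum_eval_eq_zero {F : Type*} [Field F] [Fintype F] (P : F[X])
    (hP : P.natDegree < Fintype.card F - 1) : ∑ x : F, P.eval x = 0 := by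
  simp_rw [eval_eq_sum_range]
  rw [Finset.sum_comm]
  refine Finset.sum_eq_zero fun i hi ↦ ?_
  rw [← Finset.mul_sum, FiniteField.sum_pow_lt_card_sub_one, mul_zero]
  have := Finset.mem_range.mp hi
  omega

variable {p : ℕ} {F O : Type*} [Field F] [Fintype F] [CommRing O]
  (π : O →+* F) {ζ : O}

theorem dvd_card_sub_one_of_isPrimitiveRoot [NeZero p] {z : F} (h : IsPrimitiveRoot z p) :
    p ∣ Fintype.card F - 1 := by
  refine h.dvd_of_pow_eq_one _ (FiniteField.pow_card_sub_one_eq_one z ?_)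
  exact h.ne_zero (NeZero.ne p)

/-- The power residue character attached to a residue field: it lifts `x ↦ x ^ ((#F - 1) / p)`. -/
theorem exists_powerResidueChar [NeZero p] (hζ : IsPrimitiveRoot ζ p)
    (hπ : IsPrimitiveRoot (π ζ) p) :
    ∃ χ : MulChar F O, (∀ x, π (χ x) = x ^ ((Fintype.card F - 1) / p)) ∧ χ ^ p = 1 := by
  classical
  obtain ⟨u, hu⟩ := dvd_card_sub_one_of_isPrimitiveRoot hπ
  have hp : 0 < p := NeZero.pos p
  have hF : 0 < Fintype.card F - 1 := by have := Fintype.one_lt_card (α := F); omega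
  have hu0 : u ≠ 0 := by rintro rfl; omega
  rw [hu, Nat.mul_div_cancel_left _ hp]
  obtain ⟨g, hg⟩ := IsCyclic.exists_generator (α := Fˣ)
  have hgu : ((g : F) ^ u) ^ p = 1 := by
    rw [← pow_mul, mul_comm, ← hu]
    exact FiniteField.pow_card_sub_one_eq_one _ g.ne_zero
  -- ζ^k reduces to g^u, so the character sending the generator g to ζ^k lifts x ↦ x^u.
  obtain ⟨k, -, hk⟩ := hπ.eq_pow_of_pow_eq_one hgu
  set z : Oˣ := (hζ.isUnit (NeZero.ne p)).unit with hz
  have hz1 : (z : O) = ζ := rfl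
  have hmem : z ^ k ∈ rootsOfUnity (Fintype.card Fˣ) O := by
    rw [mem_rootsOfUnity, Fintype.card_units, hu, Units.ext_iff]
    simp only [Units.val_pow_eq_pow_val, Units.val_one, hz1]
    rw [← pow_mul, mul_comm, mul_assoc, pow_mul, hζ.pow_eq_one, one_pow]
  refine ⟨MulChar.ofRootOfUnity hmem hg, fun x ↦ ?_, ?_⟩
  · rcases eq_or_ne x 0 with rfl | hx
    · rw [MulChar.map_zero, map_zero, zero_pow hu0]
    · obtain ⟨m, hm⟩ := (mem_powers_iff_mem_zpowers.mpr (hg (Units.mk0 x hx)))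
      have hxm : x = (g : F) ^ m := by
        have := congrArg Units.val hm
        simpa using this.symm
      rw [hxm, map_pow, MulChar.ofRootOfUnity_spec, map_pow, Units.val_pow_eq_pow_val, hz1,
        map_pow, hk, ← pow_mul, ← pow_mul, mul_comm]
  · rw [MulChar.eq_iff hg, MulChar.pow_apply_coe, MulChar.ofRootOfUnity_spec,
      MulChar.one_apply_coe, Units.val_pow_eq_pow_val, hz1, ← pow_mul, mul_comm, pow_mul,
      hζ.pow_eq_one, one_pow]

variable {π} {χ : MulChar F O}

/-- With #F - 1 = up, the sum reduces to ∑ x^(ua) (1 - x)^(ub), of degree at most u(a + b) < #F - 1,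
and such power sums vanish. -/
theorem map_jacobiSum_eq_zero (hp : p ∣ Fintype.card F - 1)
    (hχ : ∀ x, π (χ x) = x ^ ((Fintype.card F - 1) / p)) {a b : ℕ} (ha : a ≠ 0) (hb : b ≠ 0)
    (hab : a + b < p) : π (jacobiSum (χ ^ a) (χ ^ b)) = 0 := by
  obtain ⟨u, hu⟩ := hp
  have hF : 0 < Fintype.card F - 1 := by have := Fintype.one_lt_card (α := F); omega
  have hu0 : 0 < u := by rcases Nat.eq_zero_or_pos u with rfl | h <;> omega
  rw [hu, Nat.mul_div_cancel_left _ (by omega)] at hχ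
  rw [← FiniteField.sum_eval_eq_zero ((X : F[X]) ^ (u * a) * (1 - X) ^ (u * b))]
  · rw [jacobiSum, map_sum]
    refine Finset.sum_congr rfl fun x _ ↦ ?_
    rw [MulChar.pow_apply' _ ha, MulChar.pow_apply' _ hb, map_mul, map_pow, map_pow, hχ, hχ]
    simp [pow_mul]
  · have h1 : ((1 : F[X]) - X).natDegree ≤ 1 := by
      rw [← neg_sub, natDegree_neg]
      exact (natDegree_X_sub_C (1 : F)).le
    calc _ ≤ u * a + u * b * 1 := natDegree_mul_le_of_le (natDegree_X_pow_le _)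
            (natDegree_pow_le_of_le _ h1)
      _ = u * (a + b) := by ring
      _ < u * p := Nat.mul_lt_mul_of_pos_left hab hu0
      _ = _ := by rw [hu, mul_comm]

theorem powerResidueChar_pow_ne_one (hp : p ∣ Fintype.card F - 1)
    (hχ : ∀ x, π (χ x) = x ^ ((Fintype.card F - 1) / p)) {a : ℕ} (ha : a ≠ 0) (hap : a < p) :
    χ ^ a ≠ 1 := by
  intro h
  obtain ⟨u, hu⟩ := hp
  have hF : 0 < Fintype.card F - 1 := by have := Fintype.one_lt_card (α := F); omega
  have hu0 : 0 < u := by rcases Nat.eq_zero_or_pos u with rfl | h <;> omega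
  rw [hu, Nat.mul_div_cancel_left _ (by omega)] at hχ
  obtain ⟨g, hg⟩ := IsCyclic.exists_generator (α := Fˣ)
  have h1 : g ^ (u * a) = 1 := by
    have h2 := congrArg π (congrArg (fun φ : MulChar F O ↦ φ g) h)
    simp only [MulChar.pow_apply' _ ha, MulChar.one_apply_coe, map_pow, hχ, map_one] at h2
    ext
    rw [Units.val_pow_eq_pow_val, pow_mul, h2, Units.val_one]
  have h2 := orderOf_dvd_of_pow_eq_one h1
  classical
  rw [orderOf_eq_card_of_forall_mem_zpowers hg, Nat.card_eq_fintype_card] at h2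
  rw [Fintype.card_units, hu, mul_comm p u] at h2
  have h3 := Nat.dvd_of_mul_dvd_mul_left hu0 h2
  exact absurd (Nat.le_of_dvd (Nat.pos_of_ne_zero ha) h3) (by omega)

variable [IsDomain O]

theorem ringHom_mulChar_apply [NeZero p] (hζ : IsPrimitiveRoot ζ p) (hχ : χ ^ p = 1) {a : ℕ}
    (ha : a ≠ 0) (f : O →+* O) (hf : f ζ = ζ ^ a) : χ.ringHomComp f = χ ^ a := by
  ext x
  rw [MulChar.ringHomComp_apply, MulChar.pow_apply' _ ha]
  obtain ⟨k, -, hk⟩ := MulChar.exists_apply_eq_pow hχ hζ x.ne_zero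
  rw [hk, map_pow, hf, ← pow_mul, ← pow_mul, mul_comm]

theorem ringHom_jacobiSum [NeZero p] (hζ : IsPrimitiveRoot ζ p) (hχ : χ ^ p = 1) {a : ℕ}
    (ha : a ≠ 0) (f : O →+* O) (hf : f ζ = ζ ^ a) (j : ℕ) :
    f (jacobiSum χ (χ ^ j)) = jacobiSum (χ ^ a) (χ ^ (j * a)) := by
  rw [← jacobiSum_ringHomComp, ← MulChar.ringHomComp_pow, ringHom_mulChar_apply hζ hχ ha f hf,
    ← pow_mul, mul_comm]

theorem jacobiSum_mul_jacobiSum_inv_of_domain [CharZero O] {φ ψ : MulChar F O} (h1 : φ ≠ 1)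
    (h2 : ψ ≠ 1) (h3 : φ * ψ ≠ 1) :
    jacobiSum φ ψ * jacobiSum φ⁻¹ ψ⁻¹ = Fintype.card F := by
  have hinj : Function.Injective (algebraMap O (FractionRing O)) :=
    IsFractionRing.injective O (FractionRing O)
  have hchar : CharZero (FractionRing O) := charZero_of_injective_algebraMap hinj
  apply hinj
  rw [map_mul, ← jacobiSum_ringHomComp, ← jacobiSum_ringHomComp, map_natCast,
    ← MulChar.ringHomComp_inv, ← MulChar.ringHomComp_inv]
  refine jacobiSum_mul_jacobiSum_inv ?_ ((MulChar.ringHomComp_ne_one_iff hinj).mpr h1)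
    ((MulChar.ringHomComp_ne_one_iff hinj).mpr h2) ?_
  · rw [ringChar.eq_zero]
    exact (CharP.ringChar_ne_zero_of_finite F).symm
  · rw [← MulChar.ringHomComp_mul]
    exact (MulChar.ringHomComp_ne_one_iff hinj).mpr h3

end JacobiSums

/-! ### Stickelberger factorization at primes of prime norm -/

section CyclotomicStickelberger

open NumberField Ideal IsDedekindDomain
open scoped nonZeroDivisors Pointwise

variable (p : ℕ) [hp : Fact p.Prime] (K : Type*) [Field K] [NumberField K]
  [IsCyclotomicExtension {p} ℚ K]

/-- The automorphism of the `p`-th cyclotomic field that raises the `p`-th roots of unity to the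
power `a`. -/
noncomputable def cycloGal : (ZMod p)ˣ →* Gal(K/ℚ) :=
  (IsCyclotomicExtension.Rat.galEquivZMod p K).symm.toMonoidHom

theorem cycloGal_smul {x : 𝓞 K} (hx : x ^ p = 1) (a : (ZMod p)ˣ) :
    cycloGal p K a • x = x ^ a.val.val := by
  rw [IsCyclotomicExtension.Rat.galEquivZMod_smul_of_pow_eq p K _ hx]
  congr 3
  exact MulEquiv.apply_symm_apply _ a

theorem exists_isPrimitiveRoot_ringOfIntegers : ∃ ζ : 𝓞 K, IsPrimitiveRoot ζ p :=
  ⟨_, (IsCyclotomicExtension.zeta_spec p ℚ K).toInteger_isPrimitiveRoot⟩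

variable {K} in
theorem exists_int_sub_mem_of_prime_absNorm {q : Ideal (𝓞 K)} (hl : (absNorm q).Prime)
    (x : 𝓞 K) : ∃ n : ℤ, x - n ∈ q := by
  have hfact : Fact (absNorm q).Prime := ⟨hl⟩
  have hcard : Nat.card (𝓞 K ⧸ q) = absNorm q := by
    rw [absNorm_apply, Submodule.cardQuot_apply]
  have h1 : (1 : 𝓞 K ⧸ q) ≠ 0 := by
    rw [← map_one (Ideal.Quotient.mk q), Ne, Ideal.Quotient.eq_zero_iff_mem,
      ← Ideal.eq_top_iff_one, ← absNorm_eq_one_iff]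
    exact hl.ne_one
  obtain ⟨n, hn⟩ := AddSubgroup.mem_zmultiples_iff.mp
    (mem_zmultiples_of_prime_card hcard h1 (g' := Ideal.Quotient.mk q x))
  refine ⟨n, ?_⟩
  rw [← Ideal.Quotient.eq_zero_iff_mem, map_sub, ← hn, map_intCast]
  simp

variable {K} in
-- The residue field is a prime field, so ζ ≡ n mod q for an integer n. If σ_a fixes q then ζ^a ≡ n
-- ≡ ζ, while ζ keeps order p modulo q.
theorem cycloGal_smul_ne {q : Ideal (𝓞 K)} (hl : (absNorm q).Prime) (hlp : absNorm q ≠ p)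
    {a : (ZMod p)ˣ} (h : cycloGal p K a • q = q) : a = 1 := by
  obtain ⟨ζ, hζ⟩ := exists_isPrimitiveRoot_ringOfIntegers p K
  have hζq := hζ.idealQuotient_mk hl.ne_one ((Nat.coprime_primes hl hp.out).mpr hlp)
  obtain ⟨n, hn⟩ := exists_int_sub_mem_of_prime_absNorm hl ζ
  have h1 : cycloGal p K a • (ζ - n) ∈ q := by
    rw [← h]
    exact Ideal.smul_mem_pointwise_smul _ _ _ hn
  have h3 : cycloGal p K a • (n : 𝓞 K) = n :=
    map_intCast (MulSemiringAction.toRingHom Gal(K/ℚ) (𝓞 K) (cycloGal p K a)) n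
  rw [smul_sub, h3, cycloGal_smul p K hζ.pow_eq_one] at h1
  have h2 := q.sub_mem h1 hn
  rw [sub_sub_sub_cancel_right, ← Ideal.Quotient.eq, map_pow] at h2
  have h4 := hζq.pow_inj (ZMod.val_lt _) hp.out.one_lt (h2.trans (pow_one _).symm)
  ext
  apply ZMod.val_injective
  rw [h4, Units.val_one, ZMod.val_one]

variable {K} in
theorem eq_of_dvd_of_absNorm_eq {I J : Ideal (𝓞 K)} (h : I ∣ J) (h0 : absNorm J ≠ 0)
    (hN : absNorm I = absNorm J) : I = J := by
  obtain ⟨L, rfl⟩ := h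
  rw [map_mul] at hN h0
  have : absNorm L = 1 := by
    refine Nat.eq_of_mul_eq_mul_left (Nat.pos_of_ne_zero (left_ne_zero_of_mul h0)) ?_
    rw [← hN, mul_one]
  rw [absNorm_eq_one_iff.mp this, ← one_eq_top, mul_one]

variable {K} in
theorem isPrime_of_prime_absNorm {q : Ideal (𝓞 K)} (hl : (absNorm q).Prime) : Prime q := by
  have hirr := isPrime_of_irreducible_absNorm (Nat.irreducible_iff_nat_prime _ |>.mpr hl)
  refine Ideal.prime_of_isPrime ?_ hirr
  rintro rfl
  exact hl.ne_zero absNorm_bot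

variable {K} in
theorem prod_cycloGal_smul_dvd {q : Ideal (𝓞 K)} (hl : (absNorm q).Prime) (hlp : absNorm q ≠ p)
    (s : Finset (ZMod p)ˣ) {I : Ideal (𝓞 K)} (hI : ∀ a ∈ s, cycloGal p K a⁻¹ • q ∣ I) :
    ∏ a ∈ s, cycloGal p K a⁻¹ • q ∣ I := by
  have hprime : ∀ a : (ZMod p)ˣ, Prime (cycloGal p K a • q) := fun a ↦
    isPrime_of_prime_absNorm (by rwa [absNorm_galois_smul])
  refine Finset.prod_dvd_of_isRelPrime ?_ hI
  intro a _ b _ hab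
  refine (Irreducible.isRelPrime_iff_not_dvd (hprime a⁻¹).irreducible).mpr fun h ↦ hab ?_
  have := (Prime.dvd_prime_iff_associated (hprime a⁻¹) (hprime b⁻¹)).mp h
  rw [associated_iff_eq] at this
  have h1 : cycloGal p K (b * a⁻¹) • q = q := by
    rw [map_mul, mul_smul, this, smul_smul, ← map_mul, mul_inv_cancel, map_one, one_smul]
  exact (mul_inv_eq_one.mp (cycloGal_smul_ne p hl hlp h1)).symm

variable {K} in
-- The p - 1 conjugates are distinct primes dividing (l), and both sides have norm l^(p - 1).
theorem prod_cycloGal_smul_eq_span {q : Ideal (𝓞 K)} (hl : (absNorm q).Prime)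
    (hlp : absNorm q ≠ p) :
    ∏ a : (ZMod p)ˣ, cycloGal p K a⁻¹ • q = span {(absNorm q : 𝓞 K)} := by
  have hN : absNorm (span {(absNorm q : 𝓞 K)}) = absNorm q ^ (p - 1) := by
    rw [absNorm_span_natCast, RingOfIntegers.rank, IsCyclotomicExtension.Rat.finrank p,
      Nat.totient_prime hp.out]
  refine eq_of_dvd_of_absNorm_eq (prod_cycloGal_smul_dvd p hl hlp _ fun a _ ↦ ?_) ?_ ?_
  · rw [dvd_span_singleton]
    have h := absNorm_mem (cycloGal p K a⁻¹ • q)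
    rwa [absNorm_galois_smul] at h
  · rw [hN]
    exact pow_ne_zero _ hl.ne_zero
  · rw [hN, map_prod]
    simp_rw [absNorm_galois_smul]
    rw [Finset.prod_const, Finset.card_univ, ZMod.card_units]

/-- The residues `a` modulo `p` for which the representatives of `a` and `j * a` add up to less
than `p`. -/
def stickelbergerSet (j : ℕ) : Finset (ZMod p)ˣ :=
  Finset.univ.filter fun a ↦ (a : ZMod p).val + ((j : ZMod p) * a).val < p

variable {p} in
-- The sums for a and -a add up to 2p, and neither equals p because (j + 1)a ≠ 0.
theorem neg_mem_stickelbergerSet_iff {j : ℕ} (h1 : 1 ≤ j) (h2 : j + 1 < p) (a : (ZMod p)ˣ) :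
    -a ∈ stickelbergerSet p j ↔ a ∉ stickelbergerSet p j := by
  have hj0 : (j : ZMod p) ≠ 0 := by
    rw [Ne, ZMod.natCast_eq_zero_iff]
    exact fun h ↦ absurd (Nat.le_of_dvd (by omega) h) (by omega)
  have hj1 : ((j + 1 : ℕ) : ZMod p) ≠ 0 := by
    rw [Ne, ZMod.natCast_eq_zero_iff]
    exact fun h ↦ absurd (Nat.le_of_dvd (by omega) h) (by omega)
  simp only [stickelbergerSet, Finset.mem_filter, Finset.mem_univ, true_and, Units.val_neg,
    mul_neg]
  have ha := a.ne_zero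
  have hja := mul_ne_zero hj0 ha
  rw [ZMod.neg_val, ZMod.neg_val, if_neg ha, if_neg hja]
  have hne : (a : ZMod p).val + ((j : ZMod p) * a).val ≠ p := by
    intro h
    have h3 := congrArg (Nat.cast : ℕ → ZMod p) h
    rw [Nat.cast_add, ZMod.natCast_zmod_val, ZMod.natCast_zmod_val, ZMod.natCast_self] at h3
    refine mul_ne_zero hj1 ha ?_
    rw [← h3]
    push_cast
    ring
  have := ZMod.val_lt (a : ZMod p)
  have := ZMod.val_lt ((j : ZMod p) * (a : ZMod p))
  omega

variable {K} in
-- Take x = J(χ, χ^j). For a ∈ S_j its conjugate J(χ^a, χ^(ja)) lies in q, so σ_a⁻¹ q divides x; the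
-- complementary conjugates divide y = σ_{-1} x. Since (xy) = (l) is the product of all conjugates,
-- both divisibilities are equalities.
theorem exists_prod_cycloGal_smul_eq_span {q : Ideal (𝓞 K)} (hl : (absNorm q).Prime)
    (hlp : absNorm q ≠ p) {j : ℕ} (h1 : 1 ≤ j) (h2 : j + 1 < p) :
    ∃ x : 𝓞 K, ∏ a ∈ stickelbergerSet p j, cycloGal p K a⁻¹ • q = span {x} := by
  classical
  obtain ⟨ζ, hζ⟩ := exists_isPrimitiveRoot_ringOfIntegers p K
  have hζq := hζ.idealQuotient_mk hl.ne_one ((Nat.coprime_primes hl hp.out).mpr hlp)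
  have hqp := Ideal.isPrime_of_prime (isPrime_of_prime_absNorm hl)
  have hqm : q.IsMaximal := hqp.isMaximal (isPrime_of_prime_absNorm hl).ne_zero
  let : Field (𝓞 K ⧸ q) := Ideal.Quotient.field q
  have hcard : Nat.card (𝓞 K ⧸ q) = absNorm q := by
    rw [absNorm_apply, Submodule.cardQuot_apply]
  have : Finite (𝓞 K ⧸ q) := Nat.finite_of_card_ne_zero (hcard ▸ hl.ne_zero)
  let : Fintype (𝓞 K ⧸ q) := Fintype.ofFinite _
  rw [Nat.card_eq_fintype_card] at hcard
  obtain ⟨χ, hχ, hχp⟩ := exists_powerResidueChar (Ideal.Quotient.mk q) hζ hζq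
  have hdvd := dvd_card_sub_one_of_isPrimitiveRoot hζq
  set x := jacobiSum χ (χ ^ j) with hx
  have hgal : ∀ a : (ZMod p)ˣ, cycloGal p K a • x =
      jacobiSum (χ ^ (a : ZMod p).val) (χ ^ ((j : ZMod p) * a).val) := by
    intro a
    have h3 := ringHom_jacobiSum hζ hχp (a := (a : ZMod p).val)
      (by rw [Ne, ZMod.val_eq_zero]; exact a.ne_zero)
      (MulSemiringAction.toRingHom Gal(K/ℚ) (𝓞 K) (cycloGal p K a))
      (cycloGal_smul p K hζ.pow_eq_one a) j
    refine h3.trans ?_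
    congr 1
    refine pow_eq_pow_of_modEq ?_ hχp
    rw [← ZMod.natCast_eq_natCast_iff]
    simp
  have hmem : ∀ a ∈ stickelbergerSet p j, cycloGal p K a⁻¹ • q ∣ span {x} := by
    intro a ha
    rw [dvd_span_singleton, map_inv, Ideal.mem_inv_pointwise_smul_iff, hgal,
      ← Ideal.Quotient.eq_zero_iff_mem]
    refine map_jacobiSum_eq_zero hdvd hχ ?_ ?_ (Finset.mem_filter.mp ha).2
    · rw [Ne, ZMod.val_eq_zero]; exact a.ne_zero
    · rw [Ne, ZMod.val_eq_zero, mul_eq_zero, not_or, ZMod.natCast_eq_zero_iff]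
      exact ⟨fun h ↦ absurd (Nat.le_of_dvd (by omega) h) (by omega), a.ne_zero⟩
  set y := cycloGal p K (-1) • x with hy
  have hmem' : ∀ a ∈ (stickelbergerSet p j)ᶜ, cycloGal p K a⁻¹ • q ∣ span {y} := by
    intro a ha
    rw [Finset.mem_compl, ← neg_mem_stickelbergerSet_iff h1 h2] at ha
    have h3 := hmem (-a) ha
    rw [dvd_span_singleton, map_inv, Ideal.mem_inv_pointwise_smul_iff] at h3 ⊢
    rwa [hy, smul_smul, ← map_mul, mul_neg_one]
  have hxy : x * y = absNorm q := by
    have h4 : ∀ ψ : MulChar (𝓞 K ⧸ q) (𝓞 K), ψ ^ p = 1 → ψ ^ (-1 : ZMod p).val = ψ⁻¹ := by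
      intro ψ hψ
      rw [eq_inv_iff_mul_eq_one, ← pow_succ]
      refine (pow_eq_pow_of_modEq (b := 0) ?_ hψ).trans (pow_zero _)
      rw [← ZMod.natCast_eq_natCast_iff]
      simp
    have h5 : y = jacobiSum χ⁻¹ (χ ^ j)⁻¹ := by
      rw [hy, hx, ← h4 χ hχp, ← h4 (χ ^ j) (by rw [← pow_mul, mul_comm, pow_mul, hχp, one_pow]),
        ← hx, hgal, ← pow_mul]
      congr 1
      refine pow_eq_pow_of_modEq ?_ hχp
      rw [← ZMod.natCast_eq_natCast_iff]
      simp
    rw [h5, jacobiSum_mul_jacobiSum_inv_of_domain, hcard]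
    · simpa using powerResidueChar_pow_ne_one hdvd hχ (a := 1) one_ne_zero (by omega)
    · exact powerResidueChar_pow_ne_one hdvd hχ (by omega) (by omega)
    · rw [← pow_succ']
      exact powerResidueChar_pow_ne_one hdvd hχ (by omega) (by omega)
  refine ⟨x, ?_⟩
  have hd1 := prod_cycloGal_smul_dvd p hl hlp _ hmem
  have hd2 := prod_cycloGal_smul_dvd p hl hlp _ hmem'
  have hprod := Finset.prod_mul_prod_compl (stickelbergerSet p j)
    (fun a ↦ cycloGal p K a⁻¹ • q)
  rw [prod_cycloGal_smul_eq_span p hl hlp, ← hxy, ← span_singleton_mul_span_singleton] at hprod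
  have hxy0 : span {x} * span {y} ≠ 0 := by
    rw [span_singleton_mul_span_singleton, hxy, Ne, Ideal.zero_eq_bot, span_singleton_eq_bot]
    exact_mod_cast hl.ne_zero
  refine dvd_antisymm hd1 ?_
  obtain ⟨L, hL⟩ := hd2
  rw [hL] at hprod hxy0
  refine ⟨L, mul_right_cancel₀ (left_ne_zero_of_mul (right_ne_zero_of_mul hxy0)) ?_⟩
  rw [hprod]
  ring

end CyclotomicStickelberger

/-! ### Relations in the class group -/

section ClassGroupRelations

open NumberField Ideal IsDedekindDomain
open scoped nonZeroDivisors Pointwise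

variable (p : ℕ) [hp : Fact p.Prime] (K : Type*) [Field K] [NumberField K]
  [IsCyclotomicExtension {p} ℚ K]

variable {K} in
-- p is associated to (ζ - 1)^(p - 1), so q contains ζ - 1, which already generates an ideal of norm
-- p.
theorem isPrincipal_of_absNorm_eq {q : Ideal (𝓞 K)} (hq : absNorm q = p) :
    Submodule.IsPrincipal q := by
  have hζ := IsCyclotomicExtension.zeta_spec p ℚ K
  have hqp := Ideal.isPrime_of_prime (isPrime_of_prime_absNorm (hq ▸ hp.out))
  have h1 : (p : 𝓞 K) ∈ q := hq ▸ absNorm_mem q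
  rw [← q.unit_mul_mem_iff_mem ((IsCyclotomicExtension.Rat.associated_zeta_sub_one_pow_prime p
    hζ).symm.choose).isUnit, mul_comm,
    (IsCyclotomicExtension.Rat.associated_zeta_sub_one_pow_prime p hζ).symm.choose_spec] at h1
  have h2 := hqp.mem_of_pow_mem _ h1
  have hN : absNorm (span {hζ.toInteger - 1}) = p := by
    have h3 : IsCyclotomicExtension {p ^ (0 + 1)} ℚ K := by
      rwa [zero_add, pow_one]
    have h4 : IsPrimitiveRoot (IsCyclotomicExtension.zeta p ℚ K) (p ^ (0 + 1)) := by
      rwa [zero_add, pow_one]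
    exact IsCyclotomicExtension.Rat.absNorm_span_zeta_sub_one p 0 h4
  rw [eq_of_dvd_of_absNorm_eq (dvd_span_singleton.mpr h2) (hN.symm ▸ hp.out.ne_zero)
    (hq.trans hN.symm)]
  exact ⟨_, rfl⟩

/-- A relation between ideal classes that holds for the primes of prime norm different from `p`
holds for all ideal classes. -/
theorem mem_subgroup_classGroup_of_forall_prime (H : Subgroup (ClassGroup (𝓞 K)))
    (hH : ∀ P : HeightOneSpectrum (𝓞 K), (absNorm P.asIdeal).Prime → absNorm P.asIdeal ≠ p →
      ClassGroup.mk0 (HeightOneSpectrum.toNonZeroDivisors P) ∈ H) (c : ClassGroup (𝓞 K)) :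
    c ∈ H := by
  rw [eq_top_of_forall_mk0_mem K H]
  · exact Subgroup.mem_top c
  · intro P hP
    by_cases hPp : absNorm P.asIdeal = p
    · rw [(ClassGroup.mk0_eq_one_iff (HeightOneSpectrum.toNonZeroDivisors P).2).mpr
        (isPrincipal_of_absNorm_eq p hPp)]
      exact H.one_mem
    · exact hH P hP hPp

/-- Stickelberger's relations in the class group of the `p`-th cyclotomic field. -/
theorem prod_stickelbergerSet_galClassMap_eq_one {j : ℕ} (h1 : 1 ≤ j) (h2 : j + 1 < p)
    (c : ClassGroup (𝓞 K)) :
    ∏ a ∈ stickelbergerSet p j, galClassMap K (cycloGal p K a⁻¹) c = 1 := by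
  rw [← MonoidHom.finsetProd_apply, ← MonoidHom.mem_ker]
  refine mem_subgroup_classGroup_of_forall_prime p K _ (fun P hP hPp ↦ ?_) c
  obtain ⟨x, hx⟩ := exists_prod_cycloGal_smul_eq_span p hP hPp h1 h2
  rw [MonoidHom.mem_ker, MonoidHom.finsetProd_apply]
  set π := HeightOneSpectrum.toNonZeroDivisors P
  have h3 : ∀ a, galClassMap K (cycloGal p K a⁻¹) (ClassGroup.mk0 π) =
      ClassGroup.mk0 ⟨_, galois_smul_mem_nonZeroDivisors K (cycloGal p K a⁻¹) π⟩ := fun a ↦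
    galClassMap_mk0 K _ π _ rfl
  simp_rw [h3]
  rw [← map_prod, ClassGroup.mk0_eq_one_iff (Subtype.prop _)]
  refine ⟨x, ?_⟩
  rw [Submonoid.coe_finsetProd]
  exact hx

variable {K} in
-- Under any complex embedding σ_{-1} becomes complex conjugation: both invert ζ.
theorem cycloGal_neg_one_apply_of_mem {x : K} (hx : x ∈ maximalRealSubfield K) :
    cycloGal p K (-1) x = x := by
  have hζ := IsCyclotomicExtension.zeta_spec p ℚ K
  obtain ⟨φ⟩ : Nonempty (K →+* ℂ) := inferInstance
  have h0 : IsPrimitiveRoot hζ.toInteger p := hζ.toInteger_isPrimitiveRoot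
  have hσ : cycloGal p K (-1) (IsCyclotomicExtension.zeta p ℚ K) =
      (IsCyclotomicExtension.zeta p ℚ K)⁻¹ := by
    have h1 := congrArg (algebraMap (𝓞 K) K) (cycloGal_smul p K h0.pow_eq_one (-1))
    rw [algebraMap.smul', map_pow] at h1
    refine h1.trans ?_
    have h2 : algebraMap (𝓞 K) K hζ.toInteger = IsCyclotomicExtension.zeta p ℚ K := rfl
    rw [h2, ← mul_eq_one_iff_eq_inv₀ (hζ.ne_zero hp.out.ne_zero), ← pow_succ, hζ.pow_eq_one_iff_dvd,
      ← ZMod.natCast_eq_zero_iff]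
    simp
  have hcomp : (φ.comp (cycloGal p K (-1) : K →+* K)).toRatAlgHom =
      ((starRingEnd ℂ).comp φ).toRatAlgHom := by
    refine (hζ.powerBasis ℚ).algHom_ext ?_
    rw [IsPrimitiveRoot.powerBasis_gen]
    change φ (cycloGal p K (-1) _) = starRingEnd ℂ (φ _)
    rw [hσ, map_inv₀, Complex.inv_eq_conj]
    refine Complex.norm_eq_one_of_pow_eq_one (n := p) ?_ hp.out.ne_zero
    rw [← map_pow, hζ.pow_eq_one, map_one]
  apply φ.injective
  exact (DFunLike.congr_fun hcomp x).trans (hx φ)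

/-- For q of prime norm l ≠ p, q and σ_{-1} q are distinct and divide the extension of the prime
below q; both sides have norm l², as K is quadratic over its real subfield. -/
theorem mul_galClassMap_neg_one_mem_range (hp2 : p ≠ 2) (c : ClassGroup (𝓞 K)) :
    c * galClassMap K (cycloGal p K (-1)) c ∈
      (ClassGroup.extendedHom (𝓞 (maximalRealSubfield K)) (𝓞 K)).range := by
  have : IsCMField K := IsCyclotomicExtension.Rat.isCMField K (S := {p})
    ⟨p, rfl, lt_of_le_of_ne hp.out.two_le hp2.symm⟩
  set f : ClassGroup (𝓞 K) →* ClassGroup (𝓞 K) :=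
    MonoidHom.id _ * galClassMap K (cycloGal p K (-1))
  set A := 𝓞 (maximalRealSubfield K)
  suffices c ∈ (ClassGroup.extendedHom A (𝓞 K)).range.comap f from this
  refine mem_subgroup_classGroup_of_forall_prime p K _ (fun P hP hPp ↦ ?_) c
  set q := P.asIdeal
  set σ := cycloGal p K (-1)
  set 𝔭 := q.under A
  have hqp : q.IsPrime := P.isPrime
  have hbot : 𝔭 ≠ ⊥ := Ideal.IsIntegral.comap_ne_bot A P.ne_bot
  have hN : absNorm 𝔭 = absNorm q := by
    have h1 := absNorm_eq_pow_inertiaDeg'_of_liesOver q 𝔭 inferInstance hbot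
    have h2 := Nat.Prime.eq_one_of_pow (h1 ▸ hP)
    rw [h1, h2, pow_one]
  have hne : ¬ q ∣ σ • q := by
    intro h
    have h1 := (Prime.dvd_prime_iff_associated P.prime (isPrime_of_prime_absNorm
      (by rwa [absNorm_galois_smul]) : Prime (σ • q))).mp h
    rw [associated_iff_eq] at h1
    have h2 := cycloGal_smul_ne p hP hPp h1.symm
    have : Fact (2 < p) := ⟨lt_of_le_of_ne hp.out.two_le hp2.symm⟩
    exact ZMod.neg_one_ne_one (congrArg Units.val h2)
  have hdq : q ∣ 𝔭.map (algebraMap A (𝓞 K)) := by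
    rw [Ideal.dvd_iff_le, Ideal.map_le_iff_le_comap]
  have hdσ : σ • q ∣ 𝔭.map (algebraMap A (𝓞 K)) := by
    rw [Ideal.dvd_iff_le, Ideal.map_le_iff_le_comap]
    intro x hx
    have h1 : σ • algebraMap A (𝓞 K) x ∈ σ • q := Ideal.smul_mem_pointwise_smul _ _ _ hx
    have h2 : σ • algebraMap A (𝓞 K) x = algebraMap A (𝓞 K) x :=
      RingOfIntegers.ext (cycloGal_neg_one_apply_of_mem p x.1.2)
    rwa [h2] at h1
  have heq : q * (σ • q) = 𝔭.map (algebraMap A (𝓞 K)) := by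
    have hN2 : absNorm (𝔭.map (algebraMap A (𝓞 K))) = absNorm q ^ 2 := by
      rw [absNorm_algebraMap, hN]
      congr 1
      rw [← Algebra.IsQuadraticExtension.finrank_eq_two (maximalRealSubfield K) K]
      exact (IsFractionRing.finrank_eq A (maximalRealSubfield K) (𝓞 K) K).symm
    refine eq_of_dvd_of_absNorm_eq ?_ ?_ ?_
    · exact ((Irreducible.isRelPrime_iff_not_dvd P.irreducible).mpr hne).mul_dvd hdq hdσ
    · rw [hN2]
      exact pow_ne_zero _ hP.ne_zero
    · rw [hN2, map_mul, absNorm_galois_smul, sq]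
  refine ⟨ClassGroup.mk0 ⟨𝔭, mem_nonZeroDivisors_of_ne_zero hbot⟩, ?_⟩
  rw [ClassGroup.extendedHom_mk0]
  set π := HeightOneSpectrum.toNonZeroDivisors P
  change _ = ClassGroup.mk0 π * galClassMap K σ (ClassGroup.mk0 π)
  rw [galClassMap_mk0 K σ π ⟨_, galois_smul_mem_nonZeroDivisors K σ π⟩ rfl, ← map_mul]
  congr 1
  exact Subtype.ext heq.symm

end ClassGroupRelations

/-! ### Eigenvectors in the p-torsion of the class group -/

section Eigenclasses

variable {p : ℕ} [hp : Fact p.Prime]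

open Polynomial in
-- The minimal polynomial divides X^p - X, which splits over 𝔽_p.
theorem Module.End.exists_eigenvector_of_pow_eq_one {V : Type*} [AddCommGroup V]
    [Module (ZMod p) V] [Finite V] [Nontrivial V] (T : Module.End (ZMod p) V)
    (hT : T ^ (p - 1) = 1) : ∃ (μ : ZMod p) (x : V), x ≠ 0 ∧ T x = μ • x := by
  have hTp : T ^ p = T := by
    calc T ^ p = T ^ (p - 1 + 1) := by rw [Nat.sub_add_cancel hp.out.one_le]
      _ = T := by rw [pow_succ, hT, one_mul]
  have hfin : Module.Finite (ZMod p) V := Module.Finite.of_finite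
  have hdvd : minpoly (ZMod p) T ∣ X ^ p - X := by
    refine minpoly.dvd _ _ ?_
    rw [map_sub, map_pow, aeval_X, hTp, sub_self]
  have hsplit : (minpoly (ZMod p) T).Splits := by
    have h1 := FiniteField.splits_X_pow_card_sub_X (K := ZMod p) p
    rw [Polynomial.map_sub, Polynomial.map_pow, Polynomial.map_X, ZMod.card] at h1
    exact h1.of_dvd (FiniteField.X_pow_card_sub_X_ne_zero _ hp.out.one_lt) hdvd
  obtain ⟨μ, hμ⟩ := hsplit.exists_eval_eq_zero
    (natDegree_pos_iff_degree_pos.mp (minpoly.natDegree_pos (Algebra.IsIntegral.isIntegral T))).ne'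
  obtain ⟨x, hx, hx0⟩ := (Module.End.hasEigenvalue_of_isRoot hμ).exists_hasEigenvector
  exact ⟨μ, x, hx0, Module.End.mem_eigenspace_iff.mp hx⟩

theorem AddMonoidHom.exists_map_eq_nsmul {V : Type*} [AddCommGroup V] [Module (ZMod p) V]
    [Finite V] [Nontrivial V] (g : V →+ V) (hg : ∀ x, g^[p - 1] x = x) :
    ∃ (n : ℕ) (x : V), x ≠ 0 ∧ g x = n • x := by
  let T : Module.End (ZMod p) V := g.toZModLinearMap p
  have hT : T ^ (p - 1) = 1 := by
    refine LinearMap.ext fun x ↦ ?_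
    rw [Module.End.pow_apply, Module.End.one_apply]
    exact hg x
  obtain ⟨μ, x, hx0, hx⟩ := Module.End.exists_eigenvector_of_pow_eq_one T hT
  refine ⟨μ.val, x, hx0, ?_⟩
  rw [← Nat.cast_smul_eq_nsmul (ZMod p), ZMod.natCast_zmod_val]
  exact hx

/-- An endomorphism of a finite abelian group whose `(p - 1)`-st iterate is the identity has an
eigenvector of order `p`, as soon as `p` divides the order of the group. -/
theorem MonoidHom.exists_orderOf_eq_and_map_eq_pow {C : Type*} [CommGroup C] [Finite C]
    (hC : p ∣ Nat.card C) (f : C →* C) (hf : ∀ c, f^[p - 1] c = c) :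
    ∃ c : C, orderOf c = p ∧ ∃ n : ℕ, f c = c ^ n := by
  let V := (powMonoidHom p : C →* C).ker
  have hV : ∀ x : V, x ^ p = 1 := fun x ↦ Subtype.ext x.2
  let g : V →* V := (f.comp V.subtype).codRestrict V (by
    intro x
    have h1 : (x : C) ^ p = 1 := x.2
    change f (x : C) ^ p = 1
    rw [← map_pow, h1, map_one])
  obtain ⟨c₀, hc₀⟩ := exists_prime_orderOf_dvd_card' p hC
  have hnt : Nontrivial V := by
    refine ⟨⟨⟨c₀, ?_⟩, 1, fun h ↦ hp.out.ne_one ?_⟩⟩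
    · change c₀ ^ p = 1
      rw [← hc₀, pow_orderOf_eq_one]
    · rw [← hc₀, orderOf_eq_one_iff]
      exact congrArg Subtype.val h
  have hg : ∀ (n : ℕ) (x : Additive V),
      ((g.toAdditive)^[n] x).toMul.1 = f^[n] (x.toMul : C) := by
    intro n
    induction n with
    | zero => exact fun x ↦ rfl
    | succ n ih =>
      intro x
      rw [Function.iterate_succ_apply, ih, Function.iterate_succ_apply]
      rfl
  let : Module (ZMod p) (Additive V) := AddCommGroup.zmodModule fun x ↦ hV x.toMul
  obtain ⟨n, x, hx0, hx⟩ := AddMonoidHom.exists_map_eq_nsmul (p := p)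
    g.toAdditive fun x ↦ by
      have h1 := hg (p - 1) x
      rw [hf] at h1
      exact Additive.toMul.injective (Subtype.ext h1)
  refine ⟨x.toMul, ?_, n, congrArg (fun y : Additive V ↦ (y.toMul : C)) hx⟩
  exact orderOf_eq_prime x.toMul.2 fun h ↦ hx0 (Additive.toMul.injective (Subtype.ext h))

theorem image_pow_range_eq_univ {v : (ZMod p)ˣ} (hv : IsPrimitiveRoot v (p - 1)) :
    (Finset.range (p - 1)).image (v ^ ·) = Finset.univ := by
  refine Finset.eq_univ_of_card _ ?_
  rw [Finset.card_image_of_injOn, Finset.card_range, ZMod.card_units]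
  intro i hi j hj hij
  exact hv.pow_inj (Finset.mem_range.mp hi) (Finset.mem_range.mp hj) hij

theorem exists_lt_pow_eq {v : (ZMod p)ˣ} (hv : IsPrimitiveRoot v (p - 1)) (a : (ZMod p)ˣ) :
    ∃ i < p - 1, v ^ i = a := by
  have h := Finset.mem_univ a
  rw [← image_pow_range_eq_univ hv, Finset.mem_image] at h
  obtain ⟨i, hi, h⟩ := h
  exact ⟨i, Finset.mem_range.mp hi, h⟩

theorem sum_units_eq_sum_range {v : (ZMod p)ˣ} (hv : IsPrimitiveRoot v (p - 1))
    {M : Type*} [AddCommMonoid M] (f : (ZMod p)ˣ → M) :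
    ∑ a, f a = ∑ i ∈ Finset.range (p - 1), f (v ^ i) := by
  rw [← image_pow_range_eq_univ hv, Finset.sum_image]
  intro i hi j hj hij
  exact hv.pow_inj (Finset.mem_range.mp hi) (Finset.mem_range.mp hj) hij

theorem pow_val_eq_one_iff_of_orderOf_eq {C : Type*} [Group C] {c : C} (hc : orderOf c = p)
    (n : ℕ) : c ^ n = 1 ↔ (n : ZMod p) = 0 := by
  rw [← orderOf_dvd_iff_pow_eq_one, hc, ZMod.natCast_eq_zero_iff]

theorem pow_eq_pow_iff_of_orderOf_eq {C : Type*} [Group C] {c : C} (hc : orderOf c = p)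
    (m n : ℕ) : c ^ m = c ^ n ↔ (m : ZMod p) = n := by
  rw [ZMod.natCast_eq_natCast_iff, ← hc]
  exact pow_eq_pow_iff_modEq

open NumberField

/-- If `p` divides the class number of the `p`-th cyclotomic field, there is an ideal class of
order `p` on which the Galois group acts through a power of the cyclotomic character. -/
theorem exists_eigenclass (K : Type*) [Field K] [NumberField K] [IsCyclotomicExtension {p} ℚ K]
    {v : (ZMod p)ˣ} (hv : IsPrimitiveRoot v (p - 1)) (h : p ∣ classNumber K) :
    ∃ (c : ClassGroup (𝓞 K)) (k : ℕ), orderOf c = p ∧ k < p - 1 ∧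
      ∀ a : (ZMod p)ˣ, galClassMap K (cycloGal p K a) c = c ^ ((a ^ k : (ZMod p)ˣ) : ZMod p).val := by
  have hiter : ∀ (n : ℕ) (c : ClassGroup (𝓞 K)),
      (galClassMap K (cycloGal p K v))^[n] c = galClassMap K (cycloGal p K (v ^ n)) c := by
    intro n
    induction n with
    | zero =>
      intro c
      rw [pow_zero, map_one, galClassMap_one, Function.iterate_zero_apply]
    | succ n ih =>
      intro c
      rw [Function.iterate_succ_apply, ih, pow_succ, map_mul, galClassMap_mul]
  have hcard : p ∣ Nat.card (ClassGroup (𝓞 K)) := by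
    rwa [Nat.card_eq_fintype_card]
  obtain ⟨c, hc, n, hn⟩ := MonoidHom.exists_orderOf_eq_and_map_eq_pow hcard
    (galClassMap K (cycloGal p K v)) fun c ↦ by
      rw [hiter, hv.pow_eq_one, map_one, galClassMap_one]
  have hpow : ∀ i : ℕ, galClassMap K (cycloGal p K (v ^ i)) c = c ^ (n ^ i) := by
    intro i
    rw [← hiter]
    induction i with
    | zero => rw [pow_zero, pow_one, Function.iterate_zero_apply]
    | succ i ih => rw [Function.iterate_succ_apply', ih, map_pow, hn, ← pow_mul, pow_succ']
  -- The eigenvalue n of σ_v satisfies n^(p - 1) = 1 modulo p, so it is a power v^k of the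
  -- generator.
  have hn0 : (n : ZMod p) ≠ 0 := by
    intro h0
    have h1 := hpow (p - 1)
    rw [hv.pow_eq_one, map_one, galClassMap_one] at h1
    have h2 := (pow_eq_pow_iff_of_orderOf_eq hc 1 _).mp ((pow_one c).trans h1)
    rw [Nat.cast_pow, h0, zero_pow (by have := hp.out.two_le; omega), Nat.cast_one] at h2
    exact one_ne_zero h2
  obtain ⟨k, hk, hvk⟩ := exists_lt_pow_eq hv (Units.mk0 (n : ZMod p) hn0)
  refine ⟨c, k, hc, hk, fun a ↦ ?_⟩
  obtain ⟨i, -, rfl⟩ := exists_lt_pow_eq hv a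
  rw [hpow, pow_eq_pow_iff_of_orderOf_eq hc, ZMod.natCast_zmod_val, pow_right_comm, hvk]
  simp

end Eigenclasses

/-! ### From class relations to the congruence -/

section Congruences

variable {p : ℕ} [hp : Fact p.Prime]

open NumberField in
theorem sum_stickelbergerSet_eq_zero {K : Type*} [Field K] [NumberField K]
    [IsCyclotomicExtension {p} ℚ K] {c : ClassGroup (𝓞 K)} {k : ℕ} (hc : orderOf c = p)
    (hk : ∀ a : (ZMod p)ˣ, galClassMap K (cycloGal p K a) c =
      c ^ ((a ^ k : (ZMod p)ˣ) : ZMod p).val) {j : ℕ} (h1 : 1 ≤ j) (h2 : j + 1 < p) :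
    ∑ a ∈ stickelbergerSet p j, ((a⁻¹ ^ k : (ZMod p)ˣ) : ZMod p) = 0 := by
  have h := prod_stickelbergerSet_galClassMap_eq_one p K h1 h2 c
  simp_rw [hk] at h
  rw [Finset.prod_pow_eq_pow_sum, pow_val_eq_one_iff_of_orderOf_eq hc, Nat.cast_sum] at h
  simpa only [ZMod.natCast_zmod_val] using h

theorem sum_compl_stickelbergerSet_eq_zero {k j : ℕ} (h1 : 1 ≤ j) (h2 : j + 1 < p)
    (h : ∑ a ∈ stickelbergerSet p j, ((a⁻¹ ^ k : (ZMod p)ˣ) : ZMod p) = 0) :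
    ∑ a ∈ (stickelbergerSet p j)ᶜ, ((a⁻¹ ^ k : (ZMod p)ˣ) : ZMod p) = 0 := by
  have h3 : ∑ a ∈ (stickelbergerSet p j)ᶜ, ((a⁻¹ ^ k : (ZMod p)ˣ) : ZMod p) =
      ∑ a ∈ stickelbergerSet p j, (-1) ^ k * ((a⁻¹ ^ k : (ZMod p)ˣ) : ZMod p) := by
    refine Finset.sum_nbij' (fun a ↦ -a) (fun a ↦ -a) ?_ ?_ (fun a _ ↦ neg_neg a)
      (fun a _ ↦ neg_neg a) ?_
    · intro a ha
      rwa [neg_mem_stickelbergerSet_iff h1 h2, ← Finset.mem_compl]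
    · intro a ha
      rwa [Finset.mem_compl, neg_mem_stickelbergerSet_iff h1 h2, not_not]
    · intro a _
      rw [inv_neg, Units.val_pow_eq_pow_val, Units.val_pow_eq_pow_val, Units.val_neg, ← mul_pow,
        neg_one_mul, neg_neg]
  rw [h3, ← Finset.mul_sum, h, mul_zero]

/-- N a is ⌊m⟨a⟩/p⌋. From m to m + 1 it grows by one exactly when ⟨a⟩ + ⟨ma⟩ ≥ p, that is, off S_m,
so the weighted sum gains a vanishing complementary sum. -/
theorem exists_quotients_sum_eq_zero {k : ℕ}
    (h : ∀ j, 1 ≤ j → j + 1 < p →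
      ∑ a ∈ stickelbergerSet p j, ((a⁻¹ ^ k : (ZMod p)ˣ) : ZMod p) = 0) {m : ℕ} (h1 : 1 ≤ m)
    (h2 : m < p) :
    ∃ N : (ZMod p)ˣ → ℤ,
      (∀ a : (ZMod p)ˣ, ((a : ZMod p).val : ℤ) * m - ((m : ZMod p) * (a : ZMod p)).val = p * N a) ∧
      ∑ a, (N a : ZMod p) * ((a⁻¹ ^ k : (ZMod p)ˣ) : ZMod p) = 0 := by
  classical
  induction m, h1 using Nat.le_induction with
  | base => exact ⟨0, by simp, by simp⟩
  | succ m hm ih =>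
    obtain ⟨N, hN, hsum⟩ := ih (by omega)
    refine ⟨fun a ↦ N a + if a ∈ (stickelbergerSet p m)ᶜ then 1 else 0, fun a ↦ ?_, ?_⟩
    · beta_reduce
      have h3 := hN a
      have h4 : ((m + 1 : ℕ) : ZMod p) * (a : ZMod p) = a + (m : ZMod p) * a := by
        push_cast
        ring
      have h5 := ZMod.val_lt (a : ZMod p)
      have h6 := ZMod.val_lt ((m : ZMod p) * (a : ZMod p))
      rw [h4]
      by_cases ha : a ∈ stickelbergerSet p m
      · rw [if_neg (by simpa using ha)]
        rw [ZMod.val_add_of_lt (Finset.mem_filter.mp ha).2]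
        push_cast
        linarith
      · rw [if_pos (by simpa using ha)]
        have h7 : p ≤ (a : ZMod p).val + ((m : ZMod p) * a).val := by
          by_contra hlt
          exact ha (Finset.mem_filter.mpr ⟨Finset.mem_univ _, not_le.mp hlt⟩)
        have h8 := ZMod.val_add_val_of_le h7
        push_cast [← h8]
        have h9 : ((a : ZMod p).val : ℤ) + ((m : ZMod p) * a).val =
          ((a : ZMod p) + (m : ZMod p) * a).val + p := by exact_mod_cast h8
        linarith
    · simp_rw [Int.cast_add, Int.cast_ite, Int.cast_one, Int.cast_zero, add_mul,
        Finset.sum_add_distrib, hsum, ite_mul, one_mul, zero_mul]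
      rw [zero_add, Finset.sum_ite_mem, Finset.univ_inter]
      exact sum_compl_stickelbergerSet_eq_zero hm h2 (h m hm h2)

/-- Take m = [v] and a = v^(-i), so that δ_i = -N a. The term a = 1 drops out since [v] < p, and
multiplying the congruence by v^k turns X^(i-1) into v^(ki). -/
theorem solvesCongruence_of_sum_eq_zero {k : ℕ} {v : (ZMod p)ˣ} (hv : IsPrimitiveRoot v (p - 1))
    (h : ∀ j, 1 ≤ j → j + 1 < p →
      ∑ a ∈ stickelbergerSet p j, ((a⁻¹ ^ k : (ZMod p)ˣ) : ZMod p) = 0) {X : ℤ}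
    (hX : (X : ZMod p) = ((v ^ k : (ZMod p)ˣ) : ZMod p)) : SolvesCongruence v X := by
  have hp2 := hp.out.two_le
  obtain ⟨N, hN, hsum⟩ := exists_quotients_sum_eq_zero h (m := (v : ZMod p).val)
    (Nat.pos_of_ne_zero (by rw [Ne, ZMod.val_eq_zero]; exact v.ne_zero)) (ZMod.val_lt _)
  simp only [ZMod.natCast_zmod_val] at hN
  have hN1 : N 1 = 0 := by
    have h1 := hN 1
    have : Fact (1 < p) := ⟨hp.out.one_lt⟩
    rw [Units.val_one, mul_one, ZMod.val_one, Nat.cast_one, one_mul, sub_self] at h1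
    have hp0 : (p : ℤ) ≠ 0 := by exact_mod_cast hp.out.ne_zero
    exact (mul_eq_zero.mp h1.symm).resolve_left hp0
  have hdelta : ∀ i : ℕ, delta v i = -N (v⁻¹ ^ i) := by
    intro i
    have h1 := hN (v⁻¹ ^ i)
    have h2 : powRep v (-((i : ℤ) - 1)) - powRep v (-(i : ℤ)) * powRep v 1 =
        (p : ℤ) * -N (v⁻¹ ^ i) := by
      rw [mul_neg, ← h1, powRep, powRep, powRep, zpow_one, ← Units.val_mul]
      have h3 : v ^ (-((i : ℤ) - 1)) = v * v⁻¹ ^ i := by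
        rw [neg_sub, sub_eq_add_neg, zpow_add, zpow_one, zpow_neg, zpow_natCast, inv_pow]
      have h4 : v ^ (-(i : ℤ)) = v⁻¹ ^ i := by
        rw [zpow_neg, zpow_natCast, inv_pow]
      rw [h3, h4]
      ring
    rw [delta, h2, Int.mul_ediv_cancel_left _ (by exact_mod_cast hp.out.ne_zero)]
  rw [sum_units_eq_sum_range hv.inv, Finset.range_eq_Ico,
    Finset.sum_eq_sum_Ico_succ_bot (by omega), pow_zero, hN1, Int.cast_zero, zero_mul, zero_add] at hsum
  rw [SolvesCongruence, ← ZMod.intCast_eq_intCast_iff]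
  have hIcc : Finset.Icc 1 (p - 2) = Finset.Ico (0 + 1) (p - 1) := by
    ext i
    simp only [Finset.mem_Icc, Finset.mem_Ico]
    omega
  rw [hIcc]
  push_cast
  have hvk : ((v ^ k : (ZMod p)ˣ) : ZMod p) ≠ 0 := Units.ne_zero _
  refine (mul_eq_zero.mp ?_).resolve_left hvk
  rw [Finset.mul_sum, ← neg_eq_zero, ← hsum, ← Finset.sum_neg_distrib]
  refine Finset.sum_congr rfl fun i hi ↦ ?_
  have hi1 := (Finset.mem_Ico.mp hi).1
  rw [hX, hdelta, ← mul_assoc, ← pow_succ', Nat.sub_add_cancel (by omega), inv_pow, inv_inv]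
  push_cast
  rw [← pow_mul, ← pow_mul, mul_comm k i]
  ring

/-- For m = p - 1 the quotient is ⟨a⟩ - 1, so k = 1 would give 0 = ∑ (1 - a⁻¹) = p - 1 = -1 modulo
p. -/
theorem ne_one_of_sum_stickelbergerSet_eq_zero (hp2 : p ≠ 2) {k : ℕ}
    (h : ∀ j, 1 ≤ j → j + 1 < p →
      ∑ a ∈ stickelbergerSet p j, ((a⁻¹ ^ k : (ZMod p)ˣ) : ZMod p) = 0) : k ≠ 1 := by
  rintro rfl
  have hp3 : 2 < p := lt_of_le_of_ne hp.out.two_le hp2.symm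
  have hall : ∑ a : (ZMod p)ˣ, ((a⁻¹ ^ 1 : (ZMod p)ˣ) : ZMod p) = 0 := by
    rw [← Finset.sum_add_sum_compl (stickelbergerSet p 1), h 1 le_rfl hp3,
      sum_compl_stickelbergerSet_eq_zero le_rfl hp3 (h 1 le_rfl hp3), add_zero]
  obtain ⟨N, hN, hsum⟩ := exists_quotients_sum_eq_zero h (m := p - 1) (by omega) (by omega)
  have hN' : ∀ a, N a = (a : ZMod p).val - 1 := by
    intro a
    have h1 := hN a
    have h2 : ((p - 1 : ℕ) : ZMod p) * (a : ZMod p) = -a := by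
      rw [Nat.cast_sub hp.out.one_le]
      simp
    rw [h2, ZMod.neg_val, if_neg a.ne_zero, Nat.cast_sub (ZMod.val_lt _).le,
      Nat.cast_sub hp.out.one_le] at h1
    have hp0 : (p : ℤ) ≠ 0 := by exact_mod_cast hp.out.ne_zero
    refine mul_left_cancel₀ hp0 (h1.symm.trans ?_)
    push_cast
    ring
  have h3 : ∀ a : (ZMod p)ˣ, (N a : ZMod p) * ((a⁻¹ ^ 1 : (ZMod p)ˣ) : ZMod p) =
      1 - ((a⁻¹ ^ 1 : (ZMod p)ˣ) : ZMod p) := by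
    intro a
    rw [hN']
    push_cast
    rw [ZMod.natCast_zmod_val, pow_one, sub_mul, one_mul, mul_inv_cancel₀ a.ne_zero]
  simp_rw [h3] at hsum
  rw [Finset.sum_sub_distrib, hall, sub_zero, Finset.sum_const, Finset.card_univ, ZMod.card_units,
    nsmul_one, Nat.cast_sub hp.out.one_le] at hsum
  simp at hsum

open NumberField in
-- For even k, σ_{-1} fixes c, so c² is extended from the real subfield and p divides twice its
-- class number.
theorem odd_of_not_dvd_classNumber_maximalRealSubfield (hp2 : p ≠ 2) {K : Type*} [Field K]
    [NumberField K] [IsCyclotomicExtension {p} ℚ K] {c : ClassGroup (𝓞 K)} {k : ℕ}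
    (hc : orderOf c = p)
    (hk : galClassMap K (cycloGal p K (-1)) c = c ^ (((-1) ^ k : (ZMod p)ˣ) : ZMod p).val)
    (hplus : ¬ p ∣ classNumber (maximalRealSubfield K)) : Odd k := by
  by_contra hodd
  rw [Nat.not_odd_iff_even] at hodd
  have : Fact (1 < p) := ⟨hp.out.one_lt⟩
  obtain ⟨d, hd⟩ := mul_galClassMap_neg_one_mem_range p K hp2 c
  rw [hk, hodd.neg_one_pow, Units.val_one, ZMod.val_one, pow_one, ← sq] at hd
  have h1 : (c ^ 2) ^ classNumber (maximalRealSubfield K) = 1 := by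
    rw [← hd, ← map_pow, classNumber, pow_card_eq_one, map_one]
  rw [← pow_mul, ← orderOf_dvd_iff_pow_eq_one, hc, hp.out.dvd_mul] at h1
  rcases h1 with h1 | h1
  · exact hp2 ((Nat.prime_dvd_prime_iff_eq hp.out Nat.prime_two).mp h1)
  · exact hplus h1

end Congruences

/-! ### The regularity criterion -/

theorem corollary512301 (p : ℕ) [Fact p.Prime] (hp : p ≠ 2)
    (v : (ZMod p)ˣ) (hv : IsPrimitiveRoot v (p - 1)) :
    ((∀ X : ℤ, ¬ SolvesCongruence v X) → IsRegularPrime p) ∧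
    (¬ p ∣ NumberField.classNumber (NumberField.maximalRealSubfield (CyclotomicField p ℚ)) →
      (∀ m : ℕ, 1 ≤ m → m ≤ (p - 3) / 2 →
        ¬ SolvesCongruence v (powRep v (2 * (m : ℤ) + 1))) →
      IsRegularPrime p) := by
  have hp3 : 2 < p := lt_of_le_of_ne (Fact.out : p.Prime).two_le hp.symm
  have : IsCyclotomicExtension {p} ℚ (CyclotomicField p ℚ) := by
    have : NeZero ((p : ℕ) : ℚ) := ⟨Nat.cast_ne_zero.mpr (Fact.out : p.Prime).ne_zero⟩
    -- The cyclotomic field carries two ℚ-algebra structures, which agree because such a structure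
    -- is unique.
    have h : (DivisionRing.toRatAlgebra : Algebra ℚ (CyclotomicField p ℚ)) =
        CyclotomicField.algebra p ℚ := Subsingleton.elim _ _
    rw [h]
    exact CyclotomicField.isCyclotomicExtension p ℚ
  refine ⟨fun hX hdvd ↦ ?_, fun hplus hX hdvd ↦ ?_⟩
  · obtain ⟨c, k, hc, -, hk⟩ := exists_eigenclass (CyclotomicField p ℚ) hv hdvd
    refine hX ((v ^ k : (ZMod p)ˣ) : ZMod p).val (solvesCongruence_of_sum_eq_zero hv
      (fun j h1 h2 ↦ sum_stickelbergerSet_eq_zero hc hk h1 h2) ?_)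
    rw [Int.cast_natCast, ZMod.natCast_zmod_val]
  · obtain ⟨c, k, hc, hkp, hk⟩ := exists_eigenclass (CyclotomicField p ℚ) hv hdvd
    have hsum := fun j h1 h2 ↦ sum_stickelbergerSet_eq_zero (j := j) hc hk h1 h2
    have hk1 := ne_one_of_sum_stickelbergerSet_eq_zero hp hsum
    obtain ⟨m, rfl⟩ := odd_of_not_dvd_classNumber_maximalRealSubfield hp hc (hk (-1)) hplus
    have hodd := (Fact.out : p.Prime).odd_of_ne_two hp
    obtain ⟨r, rfl⟩ := hodd
    -- With p = 2r + 1, the conditions 2m + 1 ≠ 1 and 2m + 1 < p - 1 say exactly 1 ≤ m ≤ (p - 3)/2.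
    refine hX m (by omega) (by omega) (solvesCongruence_of_sum_eq_zero hv hsum ?_)
    rw [powRep, Int.cast_natCast, ZMod.natCast_zmod_val]
    congr 1
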